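/- Represent a partition of $n\ge 1$ by its Frobenius symbol $$\begin{pmatrix} x_1 & x_2 & \cdots & x_d\\ y_1 & y_2 & \cdots & y_d\end{pmatrix},$$ where $d$ is the number of dots on the main diagonal of its Ferrers graph, $x_i$ is the number of dots of row $i$ to the right of the diagonal, and $y_i$ is the number of dots of column $i$ below the diagonal. The column $(x_i,y_i)$ is called positive if $x_i-y_i\ge 1$ and negative if $x_i-y_i\le 0$. The parity blocks of the partition are the maximal runs of contiguous columns that are all positive (a positive block) or all negative (a negative block). For $m\ge1$ let $a^+_m(n)$ and $a^-_m(n)$ be the numbers of partitions of $n$ with exactly $m$ parity blocks whose last (rightmost) block is positive, respectively negative. Let $(q;q)_\infty=\prod_{i\ge1}(1-q^i)$, and let $p(k)$ be the number of partitions of $k$, with $p(k)=0$ for $k<0$. **Theorem.** Let $m\ge 1$. As formal power series in $q$, $$\sum_{n=1}^{\infty} a^+_m(n)\, q^n =(-1)^{m}+\frac{(-1)^{m-1}}{(q;q)_{\infty}} \sum_{l=0}^{m-1}(-1)^{l}q^{\frac{l(3l+1)}{2}}(1-q^{2l+1})$$ and $$\sum_{n=1}^{\infty} a^-_m(n)\,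 q^n =(-1)^{m}+\frac{(-1)^{m-1}}{(q;q)_{\infty}} \sum_{l=0}^{m-1}(-1)^{l}q^{\frac{l(3l-1)}{2}}(1-q^{4l+2}).$$ Equivalently, for all $n\ge 1$, $$a^+_m(n)=(-1)^{m-1}\sum_{l=0}^{m-1}(-1)^{l}\left( p\left(n-\frac{3l^2+l}{2}\right)-p\left(n-\frac{3(l+1)^2-(l+1)}{2}\right) \right)$$ and $$a^-_m(n)=(-1)^{m-1}\sum_{l=0}^{m-1}(-1)^{l}\left( p\left(n-\frac{3l^2-l}{2}\right)-p\left(n-\frac{3(l+1)^2+(l+1)}{2}\right) \right).$$ -/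

import Mathlib

namespace ParityBlocks

/-- The Ferrers graph of a partition: row `i` (counted from `0`) consists of the cells `(i, j)` with
`j` smaller than the `(i + 1)`-st largest part. -/
def ferrersGraph {n : ℕ} (p : n.Partition) : YoungDiagram :=
  YoungDiagram.ofRowLens (p.parts.sort (· ≥ ·)) (p.parts.pairwise_sort (· ≥ ·)).sortedGE

/-- The number of dots on the main diagonal of a Ferrers graph. -/
def diagonalLength (μ : YoungDiagram) : ℕ :=
  (μ.cells.filter fun c => c.1 = c.2).card

/-- The Frobenius symbol of a Ferrers graph, as the list of its columns `(x, y)`: `x` is the number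
of dots to the right of a diagonal dot in its row, `y` is the number of dots below it in its
column. The subtractions do not truncate, since `i` runs over the diagonal dots `(i, i)`. -/
def frobeniusSymbol (μ : YoungDiagram) : List (ℕ × ℕ) :=
  (List.range (diagonalLength μ)).map fun i => (μ.rowLen i - (i + 1), μ.colLen i - (i + 1))

/-- A column `(x, y)` of a Frobenius symbol is positive if `x - y ≥ 1`. -/
def ColumnPositive (c : ℕ × ℕ) : Prop := (c.1 : ℤ) - c.2 ≥ 1

/-- A column `(x, y)` of a Frobenius symbol is negative if `x - y ≤ 0`. -/
def ColumnNegative (c : ℕ × ℕ) : Prop := (c.1 : ℤ) - c.2 ≤ 0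

instance : DecidablePred ColumnPositive := fun c => inferInstanceAs (Decidable ((c.1 : ℤ) - c.2 ≥ 1))

instance : DecidablePred ColumnNegative := fun c => inferInstanceAs (Decidable ((c.1 : ℤ) - c.2 ≤ 0))

/-- Two columns have the same parity if they are both positive or both negative. -/
def SameParity (c c' : ℕ × ℕ) : Prop :=
  (ColumnPositive c ∧ ColumnPositive c') ∨ (ColumnNegative c ∧ ColumnNegative c')

instance (c c' : ℕ × ℕ) : Decidable (SameParity c c') :=
  inferInstanceAs (Decidable
    ((ColumnPositive c ∧ ColumnPositive c') ∨ (ColumnNegative c ∧ ColumnNegative c')))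

/-- The parity blocks of a partition, from left to right: the maximal runs of contiguous columns of
its Frobenius symbol that have the same parity. -/
def parityBlocks {n : ℕ} (p : n.Partition) : List (List (ℕ × ℕ)) :=
  (frobeniusSymbol (ferrersGraph p)).splitBy fun c c' => decide (SameParity c c')

/-- The last parity block exists and consists of positive columns. -/
def LastBlockPositive {n : ℕ} (p : n.Partition) : Prop :=
  ∃ B ∈ (parityBlocks p).getLast?, ∀ c ∈ B, ColumnPositive c

/-- The last parity block exists and consists of negative columns. -/
def LastBlockNegative {n : ℕ} (p : n.Partition) : Prop :=
  ∃ B ∈ (parityBlocks p).getLast?, ∀ c ∈ B, ColumnNegative c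

/-- `a⁺_m(n)`: the number of partitions of `n` with exactly `m` parity blocks, the last of which is
positive. -/
noncomputable def aPos (m n : ℕ) : ℕ :=
  Nat.card {p : n.Partition // (parityBlocks p).length = m ∧ LastBlockPositive p}

/-- `a⁻_m(n)`: the number of partitions of `n` with exactly `m` parity blocks, the last of which is
negative. -/
noncomputable def aNeg (m n : ℕ) : ℕ :=
  Nat.card {p : n.Partition // (parityBlocks p).length = m ∧ LastBlockNegative p}

/-- The partition function on the integers, `p(k) = 0` for `k < 0`. -/
def partitionCount (k : ℤ) : ℤ :=
  if 0 ≤ k then (Fintype.card (Nat.Partition k.toNat) : ℤ) else 0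

open scoped PowerSeries.WithPiTopology in
/-- `(q; q)_∞ = ∏_{i ≥ 1} (1 - q ^ i)` as a formal power series in `q = X`. -/
noncomputable def qqInfinity : PowerSeries ℚ :=
  ∏' i : ℕ, (1 - PowerSeries.X ^ (i + 1))

/-- The generating function `∑_{n ≥ 1} a(n) q ^ n` of a sequence, without a constant term. -/
noncomputable def genSeries (a : ℕ → ℕ) : PowerSeries ℚ :=
  PowerSeries.mk fun n => if 1 ≤ n then (a n : ℚ) else 0

end ParityBlocks

namespace ParityBlocks

open Finset

/-! ### Counting pairs of finite sets with alternating columns -/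

/-! The proof is a reflection principle. A Frobenius symbol is a pair (X, Y) of finite sets of equal
size. Read the entries in decreasing order, an element of Y before an equal element of X, and let
the height be the number of elements of X read minus the number of elements of Y read. A column is
positive exactly when its upper entry is read first, that is, by a step up from a height ≥ 0; it is
negative when its lower entry is read first, by a step down from a height ≤ 0. So the columns
contain an alternating sequence of `j` signs starting with a given sign exactly when the path visits
the heights 1 and -1 alternately, `j` times in all.

Reflecting the unread rest of the path at each of these visits turns such pairs into all pairs of
one fixed charge, with a fixed change of weight (`alternatingCount_eq`). At height 1 the reflection
exchanges X and Y (`pairCount_swap`); at height -1 it is the weight-preserving symmetry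
`pairCount_reflect`. Pairs of charge d and weight n number p(n - d(d-1)/2)
(`pairCount_eq_partitionCount`), so the partitions with these alternations number p(n - g) with g a
generalized pentagonal number (`alternatingPartitionCount_eq`).

Partitions that have `j` but not `j + 1` alternations from a given first sign have `j` or `j + 1`
blocks and a prescribed last sign (`alternates_sub_alternates`). Hence sums of consecutive block
counts are differences of two values of p, and an alternating sum isolates each block count
(`blockCount_eq`). -/

/-- The weight of a pair `(X, Y)` of finite sets: the size of the partition with Frobenius symbol
`(X; Y)` when `X` and `Y` have as many elements. -/
def pairWeight (X Y : Finset ℕ) : ℤ := ∑ x ∈ X, (x : ℤ) + ∑ y ∈ Y, ((y : ℤ) + 1)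

/-- The difference of the numbers of elements of `X` and `Y`. -/
def charge (X Y : Finset ℕ) : ℤ := (#X : ℤ) - #Y

/-- The number of pairs of subsets of `range k` and `range l` with given charge and weight. -/
def pairCount (k l : ℕ) (d n : ℤ) : ℕ :=
  ∑ X ∈ (range k).powerset, ∑ Y ∈ (range l).powerset,
    if charge X Y = d ∧ pairWeight X Y = n then 1 else 0

/-! ### Recursions and symmetries of the pair counts. -/

lemma notMem_of_mem_powerset_range {k : ℕ} {X : Finset ℕ} (hX : X ∈ (range k).powerset) :
    k ∉ X := fun h => by simpa using mem_powerset.1 hX h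

lemma charge_insert_left {k : ℕ} {X : Finset ℕ} (Y : Finset ℕ) (hk : k ∉ X) :
    charge (insert k X) Y = charge X Y + 1 := by
  simp [charge, hk]; ring

lemma charge_insert_right {k : ℕ} (X : Finset ℕ) {Y : Finset ℕ} (hk : k ∉ Y) :
    charge X (insert k Y) = charge X Y - 1 := by
  simp [charge, hk]; ring

lemma pairWeight_insert_left {k : ℕ} {X : Finset ℕ} (Y : Finset ℕ) (hk : k ∉ X) :
    pairWeight (insert k X) Y = pairWeight X Y + k := by
  simp [pairWeight, sum_insert hk]; ring

lemma pairWeight_insert_right {k : ℕ} (X : Finset ℕ) {Y : Finset ℕ} (hk : k ∉ Y) :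
    pairWeight X (insert k Y) = pairWeight X Y + (k + 1) := by
  simp only [pairWeight, sum_insert hk]; ring

lemma pairWeight_nonneg (X Y : Finset ℕ) : 0 ≤ pairWeight X Y := by
  unfold pairWeight; positivity

lemma pairWeight_swap (X Y : Finset ℕ) : pairWeight Y X = pairWeight X Y + charge X Y := by
  simp only [pairWeight, charge, sum_add_distrib, sum_const, nsmul_eq_mul]; ring

lemma charge_swap (X Y : Finset ℕ) : charge Y X = -charge X Y := by
  simp [charge]

lemma sum_powerset_range_succ {M : Type*} [AddCommMonoid M] (k : ℕ) (f : Finset ℕ → M) :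
    ∑ X ∈ (range (k + 1)).powerset, f X =
      ∑ X ∈ (range k).powerset, f X + ∑ X ∈ (range k).powerset, f (insert k X) := by
  rw [range_add_one, sum_powerset_insert notMem_range_self]

lemma pairCount_succ_left (k l : ℕ) (d n : ℤ) :
    pairCount (k + 1) l d n = pairCount k l d n + pairCount k l (d - 1) (n - k) := by
  unfold pairCount
  rw [sum_powerset_range_succ]
  congr 1
  refine sum_congr rfl fun X hX => sum_congr rfl fun Y _ => ?_
  rw [charge_insert_left Y (notMem_of_mem_powerset_range hX),
    pairWeight_insert_left Y (notMem_of_mem_powerset_range hX)]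
  simp only [eq_sub_iff_add_eq]

lemma pairCount_succ_right (k l : ℕ) (d n : ℤ) :
    pairCount k (l + 1) d n = pairCount k l d n + pairCount k l (d + 1) (n - (l + 1)) := by
  unfold pairCount
  simp only [sum_powerset_range_succ, sum_add_distrib]
  congr 1
  refine sum_congr rfl fun X _ => sum_congr rfl fun Y hY => ?_
  rw [charge_insert_right X (notMem_of_mem_powerset_range hY),
    pairWeight_insert_right X (notMem_of_mem_powerset_range hY)]
  simp only [eq_sub_iff_add_eq, sub_eq_iff_eq_add]

lemma pairCount_zero_zero (d n : ℤ) : pairCount 0 0 d n = if d = 0 ∧ n = 0 then 1 else 0 := by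
  rw [pairCount, range_zero, powerset_empty, sum_singleton, sum_singleton]
  simp [charge, pairWeight, eq_comm]

lemma pairCount_swap (k l : ℕ) (d n : ℤ) : pairCount k l d n = pairCount l k (-d) (n + d) := by
  unfold pairCount
  rw [sum_comm]
  refine sum_congr rfl fun Y _ => sum_congr rfl fun X _ => ?_
  rw [charge_swap X Y, pairWeight_swap X Y]
  congr 1
  apply propext
  constructor <;> rintro ⟨h1, h2⟩ <;> constructor <;> linarith

/-- An element x weighs x and an element y weighs y + 1, so the nonzero elements of X and the
shifted elements of Y both have weights 1, ..., k. Exchanging them and toggling the weightless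
element 0 of X preserves weight and sends charge d to 1 - d. In the induction, the two new largest
elements have equal weight, which makes the expansion symmetric. -/
lemma pairCount_reflect (k : ℕ) (d n : ℤ) :
    pairCount (k + 1) k d n = pairCount (k + 1) k (1 - d) n := by
  induction k generalizing d n with
  | zero =>
    simp only [pairCount_succ_left, pairCount_zero_zero]
    grind
  | succ k ih =>
    rw [pairCount_succ_left, pairCount_succ_right, pairCount_succ_right,
      pairCount_succ_left (k + 1), pairCount_succ_right _ _ (1 - d),
      pairCount_succ_right _ _ (1 - d - 1), ih d, ih (d + 1), ih (d - 1), ih (d - 1 + 1)]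
    push_cast
    ring_nf

/-- This counts the shift of a Maya diagram: raise each x by 1, lower each positive y by 1, and
either delete 0 from Y or, if it is absent, put 0 into X. The charge grows by 1 and the weight by
the old charge. -/
lemma pairCount_shift (k l : ℕ) (d n : ℤ) :
    pairCount k (l + 1) d n = pairCount (k + 1) l (d + 1) (n + d) := by
  induction k generalizing d n with
  | zero =>
    induction l generalizing d n with
    | zero =>
      simp only [pairCount_succ_left, pairCount_succ_right, pairCount_zero_zero]
      grind
    | succ l ih =>
      rw [pairCount_succ_right, pairCount_succ_right 1, ih, ih]
      push_cast
      ring_nf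
  | succ k ih =>
    rw [pairCount_succ_left, pairCount_succ_left (k + 1), ih, ih]
    push_cast
    ring_nf

lemma pairCount_of_neg (k l : ℕ) (d : ℤ) {n : ℤ} (hn : n < 0) : pairCount k l d n = 0 := by
  unfold pairCount
  refine sum_eq_zero fun X _ => sum_eq_zero fun Y _ => if_neg fun h => ?_
  linarith [pairWeight_nonneg X Y, h.2]

lemma pairCount_succ_left_of_lt {k : ℕ} (l : ℕ) (d : ℤ) {n : ℤ} (hn : n < k) :
    pairCount (k + 1) l d n = pairCount k l d n := by
  rw [pairCount_succ_left, pairCount_of_neg k l (d - 1) (by linarith), add_zero]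

/-! ### Signs of columns along the lattice path. -/

/-- Whether a sequence of signs has an alternating subsequence of length `j` that starts with the
sign `e`. -/
def alternates : ℕ → Bool → List Bool → Bool
  | 0, _, _ => true
  | _ + 1, _, [] => false
  | j + 1, e, s :: t => if s = e then alternates j (!e) t else alternates (j + 1) e t

/-- The signs of the columns formed by two rows, of which the first `h` entries of the second (the
first `-h` entries of the first, if `h` is negative) are left out. -/
def columnSigns (h : ℤ) (xs ys : List ℕ) : List Bool :=
  List.zipWith (fun x y => decide (y < x)) (xs.drop (-h).toNat) (ys.drop h.toNat)

/-- The elements of a finite set in decreasing order. -/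
def descending (X : Finset ℕ) : List ℕ := X.sort (· ≥ ·)

lemma length_descending (X : Finset ℕ) : (descending X).length = #X := by simp [descending]

lemma mem_descending {X : Finset ℕ} {x : ℕ} : x ∈ descending X ↔ x ∈ X := by simp [descending]

lemma descending_insert {k : ℕ} {X : Finset ℕ} (hX : X ∈ (range k).powerset) :
    descending (insert k X) = k :: descending X :=
  sort_insert _ (fun _ hb => (mem_range.1 (mem_powerset.1 hX hb)).le)
    (notMem_of_mem_powerset_range hX)

/-- At negative height the new entry completes a column opened by an element of Y, whose sign is
already known. -/
lemma columnSigns_cons_left_of_neg {h : ℤ} (hh : h < 0) (k : ℕ) (xs ys : List ℕ) :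
    columnSigns h (k :: xs) ys = columnSigns (h + 1) xs ys := by
  obtain ⟨m, rfl⟩ : ∃ m : ℕ, h = -(m + 1) := ⟨(-h - 1).toNat, by omega⟩
  have h1 : (-(-((m : ℤ) + 1))).toNat = m + 1 := by omega
  have h2 : (-(-((m : ℤ) + 1) + 1)).toNat = m := by omega
  have h3 : (-((m : ℤ) + 1)).toNat = 0 := by omega
  have h4 : (-((m : ℤ) + 1) + 1).toNat = 0 := by omega
  simp only [columnSigns, h1, h2, h3, h4, List.drop_succ_cons, List.drop_zero]

lemma columnSigns_cons_right_of_pos {h : ℤ} (hh : 0 < h) (k : ℕ) (xs ys : List ℕ) :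
    columnSigns h xs (k :: ys) = columnSigns (h - 1) xs ys := by
  obtain ⟨m, rfl⟩ : ∃ m : ℕ, h = m + 1 := ⟨(h - 1).toNat, by omega⟩
  have h1 : (-((m : ℤ) + 1)).toNat = 0 := by omega
  have h2 : (-((m : ℤ) + 1 - 1)).toNat = 0 := by omega
  have h3 : ((m : ℤ) + 1).toNat = m + 1 := by omega
  have h4 : ((m : ℤ) + 1 - 1).toNat = m := by omega
  simp only [columnSigns, h1, h2, h3, h4, List.drop_succ_cons, List.drop_zero]

/-- At height ≥ 0 the new entry opens a column. Its partner is still unread, hence strictly smaller,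
and the sign is settled at once. -/
lemma columnSigns_cons_left_of_nonneg {h : ℤ} (hh : 0 ≤ h) {k : ℕ} (xs : List ℕ) {ys : List ℕ}
    (hys : ∀ y ∈ ys, y < k) (hlen : h < ys.length) :
    columnSigns h (k :: xs) ys = true :: columnSigns (h + 1) xs ys := by
  lift h to ℕ using hh
  have hl : h < ys.length := by exact_mod_cast hlen
  have h1 : (-(h : ℤ)).toNat = 0 := by omega
  have h2 : (-((h : ℤ) + 1)).toNat = 0 := by omega
  have h3 : ((h : ℤ) + 1).toNat = h + 1 := by omega
  simp only [columnSigns, h1, h2, h3, Int.toNat_natCast, List.drop_zero,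
    List.drop_eq_getElem_cons hl, List.zipWith_cons_cons]
  simp [hys _ (List.getElem_mem hl)]

/-- The bound `x ≤ k` is weak because a column with equal entries counts as negative; this is why
`k` is read in the second set before the first. -/
lemma columnSigns_cons_right_of_nonpos {h : ℤ} (hh : h ≤ 0) {k : ℕ} {xs : List ℕ} (ys : List ℕ)
    (hxs : ∀ x ∈ xs, x ≤ k) (hlen : -h < xs.length) :
    columnSigns h xs (k :: ys) = false :: columnSigns (h - 1) xs ys := by
  obtain ⟨m, rfl⟩ : ∃ m : ℕ, h = -m := ⟨(-h).toNat, by omega⟩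
  have hl : m < xs.length := by omega
  have h1 : (-(-(m : ℤ) - 1)).toNat = m + 1 := by omega
  have h2 : (-(m : ℤ) - 1).toNat = 0 := by omega
  have h3 : (-(m : ℤ)).toNat = 0 := by omega
  simp only [columnSigns, h1, h2, h3, neg_neg, Int.toNat_natCast, List.drop_zero,
    List.drop_eq_getElem_cons hl, List.zipWith_cons_cons]
  simp [hxs _ (List.getElem_mem hl)]

/-- The number of pairs of subsets of `range k` and `range l` with charge `-h` and weight `n` for
which the columns that are still to be formed when `h` entries are pending have an alternating
sequence of `j` signs that starts with `e`. -/
def alternatingCount (k l : ℕ) (h : ℤ) (j : ℕ) (e : Bool) (n : ℤ) : ℕ :=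
  ∑ X ∈ (range k).powerset, ∑ Y ∈ (range l).powerset,
    if charge X Y = -h ∧ pairWeight X Y = n ∧
      alternates j e (columnSigns h (descending X) (descending Y)) = true then 1 else 0

lemma alternatingCount_zero (k l : ℕ) (h : ℤ) (e : Bool) (n : ℤ) :
    alternatingCount k l h 0 e n = pairCount k l (-h) n := by
  simp [alternatingCount, pairCount, alternates]

/-- Adding a largest element to the first set, when this does not complete a stage. -/
lemma alternatingCount_succ_left (k : ℕ) {h : ℤ} (j : ℕ) (e : Bool) (n : ℤ)
    (hh : h < 0 ∨ e = false) :
    alternatingCount (k + 1) k h (j + 1) e n =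
      alternatingCount k k h (j + 1) e n + alternatingCount k k (h + 1) (j + 1) e (n - k) := by
  unfold alternatingCount
  rw [sum_powerset_range_succ]
  congr 1
  refine sum_congr rfl fun X hX => sum_congr rfl fun Y hY => ?_
  rw [charge_insert_left Y (notMem_of_mem_powerset_range hX),
    pairWeight_insert_left Y (notMem_of_mem_powerset_range hX), descending_insert hX]
  -- This charge forces `h < #Y`, so that the new entry has a partner; for any other charge both
  -- summands vanish.
  by_cases hc : charge X Y = -(h + 1)
  · have key : alternates (j + 1) e (columnSigns h (k :: descending X) (descending Y)) =
        alternates (j + 1) e (columnSigns (h + 1) (descending X) (descending Y)) := by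
      rcases lt_or_ge h 0 with h0 | h0
      · rw [columnSigns_cons_left_of_neg h0]
      · obtain rfl : e = false := by grind
        rw [columnSigns_cons_left_of_nonneg h0 _
          (fun y hy => mem_range.1 (mem_powerset.1 hY (mem_descending.1 hy)))
          (by rw [length_descending]; simp only [charge] at hc; omega)]
        simp [alternates]
    rw [key]
    grind
  · rw [if_neg (by grind), if_neg (by grind)]

/-- The step from height 0 to 1 opens a positive column: one awaited sign is found and the next one
is negative. -/
lemma alternatingCount_succ_left_hit (k : ℕ) (j : ℕ) (n : ℤ) :
    alternatingCount (k + 1) k 0 (j + 1) true n =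
      alternatingCount k k 0 (j + 1) true n + alternatingCount k k 1 j false (n - k) := by
  unfold alternatingCount
  rw [sum_powerset_range_succ]
  congr 1
  refine sum_congr rfl fun X hX => sum_congr rfl fun Y hY => ?_
  rw [charge_insert_left Y (notMem_of_mem_powerset_range hX),
    pairWeight_insert_left Y (notMem_of_mem_powerset_range hX), descending_insert hX]
  by_cases hc : charge X Y = -1
  · have key : alternates (j + 1) true (columnSigns 0 (k :: descending X) (descending Y)) =
        alternates j false (columnSigns 1 (descending X) (descending Y)) := by
      rw [columnSigns_cons_left_of_nonneg le_rfl _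
        (fun y hy => mem_range.1 (mem_powerset.1 hY (mem_descending.1 hy)))
        (by rw [length_descending]; simp only [charge] at hc; omega)]
      simp [alternates]
    rw [key]
    grind
  · rw [if_neg (by grind), if_neg (by grind)]

lemma alternatingCount_succ_right (k : ℕ) {h : ℤ} (j : ℕ) (e : Bool) (n : ℤ)
    (hh : 0 < h ∨ e = true) :
    alternatingCount (k + 1) (k + 1) h (j + 1) e n =
      alternatingCount (k + 1) k h (j + 1) e n +
        alternatingCount (k + 1) k (h - 1) (j + 1) e (n - (k + 1)) := by
  unfold alternatingCount
  rw [← sum_add_distrib]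
  refine sum_congr rfl fun X hX => ?_
  rw [sum_powerset_range_succ]
  congr 1
  refine sum_congr rfl fun Y hY => ?_
  rw [charge_insert_right X (notMem_of_mem_powerset_range hY),
    pairWeight_insert_right X (notMem_of_mem_powerset_range hY), descending_insert hY]
  by_cases hc : charge X Y = -(h - 1)
  · have key : alternates (j + 1) e (columnSigns h (descending X) (k :: descending Y)) =
        alternates (j + 1) e (columnSigns (h - 1) (descending X) (descending Y)) := by
      rcases lt_or_ge 0 h with h0 | h0
      · rw [columnSigns_cons_right_of_pos h0]
      · obtain rfl : e = true := by grind
        rw [columnSigns_cons_right_of_nonpos h0 _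
          (fun x hx => Nat.lt_succ_iff.1 (mem_range.1 (mem_powerset.1 hX (mem_descending.1 hx))))
          (by rw [length_descending]; simp only [charge] at hc; omega)]
        simp [alternates]
    rw [key]
    grind
  · rw [if_neg (by grind), if_neg (by grind)]

/-- The mirror case: the step from 0 to -1 opens the awaited negative column. -/
lemma alternatingCount_succ_right_hit (k : ℕ) (j : ℕ) (n : ℤ) :
    alternatingCount (k + 1) (k + 1) 0 (j + 1) false n =
      alternatingCount (k + 1) k 0 (j + 1) false n +
        alternatingCount (k + 1) k (-1) j true (n - (k + 1)) := by
  unfold alternatingCount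
  rw [← sum_add_distrib]
  refine sum_congr rfl fun X hX => ?_
  rw [sum_powerset_range_succ]
  congr 1
  refine sum_congr rfl fun Y hY => ?_
  rw [charge_insert_right X (notMem_of_mem_powerset_range hY),
    pairWeight_insert_right X (notMem_of_mem_powerset_range hY), descending_insert hY]
  by_cases hc : charge X Y = 1
  · have key : alternates (j + 1) false (columnSigns 0 (descending X) (k :: descending Y)) =
        alternates j true (columnSigns (-1) (descending X) (descending Y)) := by
      rw [columnSigns_cons_right_of_nonpos le_rfl _
        (fun x hx => Nat.lt_succ_iff.1 (mem_range.1 (mem_powerset.1 hX (mem_descending.1 hx))))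
        (by rw [length_descending]; simp only [charge] at hc; omega)]
      simp [alternates]
    rw [key]
    grind
  · rw [if_neg (by grind), if_neg (by grind)]

/-! ### The reflection principle. -/

/-- The charge to which repeated reflection moves the pairs with `j` alternations. -/
def reflectedCharge : ℕ → Bool → ℤ
  | 0, _ => 0
  | j + 1, true => 2 - reflectedCharge j false
  | j + 1, false => -1 - reflectedCharge j true

/-- The change of weight under repeated reflection. -/
def reflectedShift : ℕ → Bool → ℤ
  | 0, _ => 0
  | j + 1, true => reflectedShift j false + reflectedCharge (j + 1) true - 1
  | j + 1, false => reflectedShift j true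

lemma reflectedCharge_sign (j : ℕ) :
    (0 ≤ reflectedCharge j true ∧ reflectedCharge j false ≤ 0) := by
  induction j with
  | zero => simp [reflectedCharge]
  | succ j ih => simp only [reflectedCharge]; omega

/-- The hypothesis on `h` puts the path on the side of 0 where the awaited sign can only come from a
step leaving height 0. Away from that step both sides obey the same recursion; at that step the
induction hypothesis with one stage fewer is reflected. The induction reads `k` in the second set,
then `k` in the first. -/
theorem alternatingCount_eq (k : ℕ) (h : ℤ) (j : ℕ) (e : Bool) (n : ℤ)
    (hh : if e then h ≤ 0 else 0 ≤ h) :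
    alternatingCount k k h j e n =
      pairCount k k (reflectedCharge j e - h) (n - reflectedShift j e) := by
  induction k generalizing h j e n with
  | zero =>
    cases j with
    | zero => simp [alternatingCount_zero, reflectedCharge, reflectedShift]
    | succ j =>
      -- Nothing is left to read, so no column can appear; on the other side the charge is nonzero,
      -- as the reflected charge is ≥ 2 or ≤ -1 while `h` lies weakly on the opposite side of 0.
      rw [pairCount_zero_zero, if_neg]
      · simp [alternatingCount, columnSigns, descending, alternates]
      · have := reflectedCharge_sign j
        cases e <;> simp [reflectedCharge] at hh ⊢ <;> omega
  | succ k ih =>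
    -- The intermediate state: `k` has been read in the second set but not yet in the first.
    have odd : ∀ (h : ℤ) (j : ℕ) (e : Bool) (n : ℤ), (if e then h ≤ 0 else 0 ≤ h) →
        alternatingCount (k + 1) k h j e n =
          pairCount (k + 1) k (reflectedCharge j e - h) (n - reflectedShift j e) := by
      intro h j e n hh
      cases j with
      | zero => simp [alternatingCount_zero, reflectedCharge, reflectedShift]
      | succ j =>
        rw [pairCount_succ_left]
        by_cases h0 : h < 0 ∨ e = false
        · rw [alternatingCount_succ_left k j e n h0, ih h _ e n hh, ih (h + 1) _ e _ (by grind)]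
          ring_nf
        · obtain ⟨rfl, rfl⟩ : h = 0 ∧ e = true := by grind
          -- Reflection at height 1; here the weight changes by the charge, which accounts for
          -- `reflectedShift`.
          rw [alternatingCount_succ_left_hit, ih 0 _ true n hh, ih 1 _ false _ (by simp),
            pairCount_swap k k (reflectedCharge j false - 1)]
          simp only [reflectedCharge, reflectedShift]
          ring_nf
    cases j with
    | zero => simp [alternatingCount_zero, reflectedCharge, reflectedShift]
    | succ j =>
      rw [pairCount_succ_right]
      by_cases h0 : 0 < h ∨ e = true
      · rw [alternatingCount_succ_right k j e n h0, odd h _ e n hh, odd (h - 1) _ e _ (by grind)]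
        ring_nf
      · obtain ⟨rfl, rfl⟩ : h = 0 ∧ e = false := by grind
        -- Reflection at height -1, where the ranges `k + 1` and `k` make it preserve weight.
        rw [alternatingCount_succ_right_hit, odd 0 _ false n hh, odd (-1) _ true _ (by simp),
          pairCount_reflect k (reflectedCharge j true - -1)]
        simp only [reflectedCharge, reflectedShift]
        ring_nf

/-! ### Young diagrams and their Frobenius symbols -/

lemma diag_mem_iff (μ : YoungDiagram) (i : ℕ) : (i, i) ∈ μ ↔ i < diagonalLength μ := by
  have hex : ∃ D, (D, D) ∉ μ := by
    obtain ⟨j, hj⟩ := μ.exists_notMem_row 0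
    exact ⟨j, fun h => hj (μ.up_left_mem (Nat.zero_le _) le_rfl h)⟩
  have hD : ∀ i, (i, i) ∈ μ ↔ i < Nat.find hex := fun i =>
    ⟨fun h => not_le.1 fun hle => Nat.find_spec hex (μ.up_left_mem hle hle h),
      fun h => not_not.1 (Nat.find_min hex h)⟩
  have hfilter : (μ.cells.filter fun c => c.1 = c.2) =
      (range (Nat.find hex)).map ⟨fun i => (i, i), fun a b h => (Prod.ext_iff.1 h).1⟩ := by
    ext ⟨a, b⟩
    simp only [mem_filter, YoungDiagram.mem_cells, mem_map, mem_range]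
    constructor
    · rintro ⟨h, rfl⟩
      exact ⟨a, (hD a).1 h, rfl⟩
    · rintro ⟨c, hc, h⟩
      obtain ⟨rfl, rfl⟩ := Prod.ext_iff.1 h
      exact ⟨(hD c).2 hc, rfl⟩
  rw [hD, diagonalLength, hfilter, card_map, card_range]

lemma lt_rowLen_of_lt_diagonalLength {μ : YoungDiagram} {i : ℕ} (hi : i < diagonalLength μ) :
    i < μ.rowLen i := YoungDiagram.mem_iff_lt_rowLen.1 ((diag_mem_iff μ i).2 hi)

lemma lt_colLen_of_lt_diagonalLength {μ : YoungDiagram} {i : ℕ} (hi : i < diagonalLength μ) :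
    i < μ.colLen i := YoungDiagram.mem_iff_lt_colLen.1 ((diag_mem_iff μ i).2 hi)

lemma mem_iff_of_le {μ : YoungDiagram} {i j : ℕ} (hij : i ≤ j) :
    (i, j) ∈ μ ↔ i < diagonalLength μ ∧ j < μ.rowLen i := by
  rw [← diag_mem_iff, YoungDiagram.mem_iff_lt_rowLen, YoungDiagram.mem_iff_lt_rowLen]
  omega

lemma mem_iff_of_ge {μ : YoungDiagram} {i j : ℕ} (hij : j ≤ i) :
    (i, j) ∈ μ ↔ j < diagonalLength μ ∧ i < μ.colLen j := by
  rw [← diag_mem_iff, YoungDiagram.mem_iff_lt_colLen, YoungDiagram.mem_iff_lt_colLen]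
  omega

/-- A cell on or right of the diagonal is controlled by the length of its row, a cell on or below it
by that of its column, and only rows and columns through diagonal dots matter. -/
lemma frobeniusSymbol_injective : Function.Injective frobeniusSymbol := by
  intro μ ν h
  have hd : diagonalLength μ = diagonalLength ν := by
    simpa [frobeniusSymbol] using congrArg List.length h
  have hcol : ∀ i < diagonalLength μ, μ.rowLen i = ν.rowLen i ∧ μ.colLen i = ν.colLen i := by
    intro i hi
    simp only [frobeniusSymbol, ← hd] at h
    have := List.map_inj_left.1 h i (List.mem_range.2 hi)
    have h1 := lt_rowLen_of_lt_diagonalLength hi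
    have h2 := lt_colLen_of_lt_diagonalLength hi
    have h3 := lt_rowLen_of_lt_diagonalLength (hd ▸ hi)
    have h4 := lt_colLen_of_lt_diagonalLength (hd ▸ hi)
    simp only [Prod.mk.injEq] at this
    omega
  ext ⟨i, j⟩
  simp only [YoungDiagram.mem_cells]
  rcases le_total i j with hij | hij
  · rw [mem_iff_of_le hij, mem_iff_of_le hij, ← hd]
    exact and_congr_right fun hi => by rw [(hcol i hi).1]
  · rw [mem_iff_of_ge hij, mem_iff_of_ge hij, ← hd]
    exact and_congr_right fun hi => by rw [(hcol j hi).2]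

lemma pairwise_frobeniusSymbol (μ : YoungDiagram) :
    (frobeniusSymbol μ).Pairwise fun c c' => c.1 > c'.1 ∧ c.2 > c'.2 := by
  rw [frobeniusSymbol, List.pairwise_map]
  refine List.Pairwise.imp_of_mem ?_ (List.pairwise_lt_range (n := diagonalLength μ))
  intro a b _ hb hab
  have hb := List.mem_range.1 hb
  have h1 := μ.rowLen_anti a b hab.le
  have h2 := μ.colLen_anti a b hab.le
  have h3 := lt_rowLen_of_lt_diagonalLength hb
  have h4 := lt_colLen_of_lt_diagonalLength hb
  dsimp only
  omega

/-- The fibres of `min c.1 c.2` are the hooks at the diagonal dots. -/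
lemma card_eq_sum_frobeniusSymbol (μ : YoungDiagram) :
    #μ.cells = ((frobeniusSymbol μ).map fun c => c.1 + (c.2 + 1)).sum := by
  have hmaps : ∀ c ∈ μ.cells, min c.1 c.2 ∈ range (diagonalLength μ) := by
    intro c hc
    rw [mem_range, ← diag_mem_iff]
    exact μ.up_left_mem (min_le_left _ _) (min_le_right _ _) hc
  rw [card_eq_sum_card_fiberwise hmaps, frobeniusSymbol, List.map_map,
    ← List.sum_toFinset _ List.nodup_range, List.toFinset_range]
  refine sum_congr rfl fun i hi => ?_
  have hi := mem_range.1 hi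
  have hfib : (μ.cells.filter fun c => min c.1 c.2 = i) =
      ({i} ×ˢ Ico i (μ.rowLen i)) ∪ (Ioo i (μ.colLen i) ×ˢ {i}) := by
    ext ⟨a, b⟩
    simp only [mem_filter, YoungDiagram.mem_cells, mem_union, mem_product, mem_singleton, mem_Ico,
      mem_Ioo]
    rcases le_or_gt a b with hab | hab
    · rw [mem_iff_of_le hab, min_eq_left hab]
      constructor
      · rintro ⟨⟨_, h⟩, rfl⟩
        exact Or.inl ⟨rfl, hab, h⟩
      · rintro (⟨rfl, _, h⟩ | ⟨⟨h, _⟩, rfl⟩)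
        · exact ⟨⟨hi, h⟩, rfl⟩
        · omega
    · rw [mem_iff_of_ge hab.le, min_eq_right hab.le]
      constructor
      · rintro ⟨⟨_, h⟩, rfl⟩
        exact Or.inr ⟨⟨hab, h⟩, rfl⟩
      · rintro (⟨rfl, h, _⟩ | ⟨⟨_, h⟩, rfl⟩)
        · omega
        · exact ⟨⟨hi, h⟩, rfl⟩
  have hdisj : Disjoint ({i} ×ˢ Ico i (μ.rowLen i)) (Ioo i (μ.colLen i) ×ˢ {i}) := by
    rw [disjoint_left]
    rintro ⟨a, b⟩
    simp only [mem_product, mem_singleton, mem_Ico, mem_Ioo]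
    omega
  rw [hfib, card_union_of_disjoint hdisj]
  have h1 := lt_rowLen_of_lt_diagonalLength hi
  have h2 := lt_colLen_of_lt_diagonalLength hi
  simp only [card_product, card_singleton, Nat.card_Ico, Nat.card_Ioo, Function.comp_apply]
  omega

/-- Strict decrease of the Frobenius coordinates becomes weak decrease of row and column lengths;
this makes the prescribed cells a lower set. -/
lemma add_antitone_of_strictAnti {d : ℕ} {x : ℕ → ℕ}
    (hx : ∀ i j, i < j → j < d → x j < x i) {i j : ℕ} (hij : i ≤ j) (hj : j < d) :
    x j + j ≤ x i + i := by
  induction j, hij using Nat.le_induction with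
  | base => exact le_rfl
  | succ j hij ih =>
    have := hx j (j + 1) (Nat.lt_succ_self j) hj
    have := ih (by omega)
    omega

/-- The cells of the Young diagram with Frobenius coordinates `x i` and `y i`, for `i < d`. -/
lemma exists_youngDiagram {d : ℕ} {x y : ℕ → ℕ} (hx : ∀ i j, i < j → j < d → x j < x i)
    (hy : ∀ i j, i < j → j < d → y j < y i) :
    ∃ μ : YoungDiagram, ∀ a b, (a, b) ∈ μ ↔
      (a ≤ b ∧ a < d ∧ b ≤ x a + a) ∨ (b < a ∧ b < d ∧ a ≤ y b + b) := by
  have hX {i j : ℕ} := add_antitone_of_strictAnti (i := i) (j := j) hx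
  have hY {i j : ℕ} := add_antitone_of_strictAnti (i := i) (j := j) hy
  have hlower : IsLowerSet (((range (x 0 + y 0 + d + 1) ×ˢ range (x 0 + y 0 + d + 1)).filter fun c =>
      (c.1 ≤ c.2 ∧ c.1 < d ∧ c.2 ≤ x c.1 + c.1) ∨ (c.2 < c.1 ∧ c.2 < d ∧ c.1 ≤ y c.2 + c.2) :
      Finset (ℕ × ℕ)) : Set (ℕ × ℕ)) := by
    intro c c' hcc h
    obtain ⟨a, b⟩ := c
    obtain ⟨a', b'⟩ := c'
    obtain ⟨ha, hb⟩ := hcc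
    simp only [coe_filter, mem_product, mem_range, Set.mem_ofPred_eq] at h ha hb ⊢
    refine ⟨by omega, ?_⟩
    rcases le_or_gt a' b' with hab | hab
    · left
      rcases h.2 with h | h
      · have := hX ha h.2.1
        omega
      · have := hX (i := a') (j := b) (by omega) h.2.1
        omega
    · right
      rcases h.2 with h | h
      · have := hY (i := b') (j := a) (by omega) h.2.1
        omega
      · have := hY hb h.2.1
        omega
  refine ⟨⟨_, hlower⟩, fun a b => ?_⟩
  rw [YoungDiagram.mem_mk, mem_filter, and_iff_right_iff_imp]
  rintro (h | h)
  · have := hX (Nat.zero_le a) h.2.1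
    simp only [mem_product, mem_range] at h ⊢
    omega
  · have := hY (Nat.zero_le b) h.2.1
    simp only [mem_product, mem_range] at h ⊢
    omega

lemma exists_frobeniusSymbol_eq {L : List (ℕ × ℕ)}
    (hL : L.Pairwise fun c c' => c.1 > c'.1 ∧ c.2 > c'.2) :
    ∃ μ : YoungDiagram, frobeniusSymbol μ = L := by
  set x : ℕ → ℕ := fun i => (L.getD i (0, 0)).1 with hxdef
  set y : ℕ → ℕ := fun i => (L.getD i (0, 0)).2 with hydef
  have hlt : ∀ i j, i < j → j < L.length → x j < x i ∧ y j < y i := by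
    intro i j hij hj
    have := List.pairwise_iff_getElem.1 hL i j (hij.trans hj) hj hij
    simpa [hxdef, hydef, hj, hij.trans hj] using this
  obtain ⟨μ, hμ⟩ := exists_youngDiagram (fun i j hij hj => (hlt i j hij hj).1)
    (fun i j hij hj => (hlt i j hij hj).2)
  have hd : diagonalLength μ = L.length := by
    refine Nat.le_antisymm ?_ ?_
    · by_contra! h
      have := (hμ _ _).1 ((diag_mem_iff μ _).2 h)
      omega
    · by_contra! h
      have := (diag_mem_iff μ (diagonalLength μ)).1 ((hμ _ _).2 (by omega))
      omega
  refine ⟨μ, List.ext_getElem (by simp [frobeniusSymbol, hd]) fun i hi hi' => ?_⟩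
  have hrow : μ.rowLen i = x i + i + 1 := by
    refine Nat.le_antisymm ?_ ?_
    · by_contra! h
      have := (hμ _ _).1 (YoungDiagram.mem_iff_lt_rowLen.2 h)
      omega
    · by_contra! h
      have := YoungDiagram.mem_iff_lt_rowLen.1 ((hμ i (x i + i)).2 (by omega))
      omega
  have hcol : μ.colLen i = y i + i + 1 := by
    refine Nat.le_antisymm ?_ ?_
    · by_contra! h
      have := (hμ _ _).1 (YoungDiagram.mem_iff_lt_colLen.2 h)
      omega
    · by_contra! h
      have : (y i + i, i) ∈ μ := by
        rw [hμ]
        -- If `y i = 0`, this cell is the diagonal dot, which belongs to the first alternative.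
        rcases Nat.eq_zero_or_pos (y i) with h0 | h0 <;> omega
      have := YoungDiagram.mem_iff_lt_colLen.1 this
      omega
  simp only [frobeniusSymbol, List.getElem_map, List.getElem_range, hrow, hcol]
  ext <;> simp [hxdef, hydef, hi', add_assoc]

/-! ### Partitions and Young diagrams -/

lemma card_cellsOfRowLens (w : List ℕ) : #(YoungDiagram.cellsOfRowLens w) = w.sum := by
  induction w with
  | nil => simp [YoungDiagram.cellsOfRowLens]
  | cons a w ih =>
    rw [YoungDiagram.cellsOfRowLens, card_union_of_disjoint, card_map, ih]
    · simp
    · rw [disjoint_left]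
      rintro ⟨i, j⟩ h
      simp only [mem_product, mem_singleton, mem_range] at h
      simp [h.1]

lemma card_ferrersGraph {n : ℕ} (p : n.Partition) : #(ferrersGraph p).cells = n := by
  refine (card_cellsOfRowLens _).trans ?_
  rw [← Multiset.sum_coe, Multiset.sort_eq, p.parts_sum]

lemma ferrersGraph_injective (n : ℕ) :
    Function.Injective (ferrersGraph : n.Partition → YoungDiagram) := by
  intro p q h
  have key : ∀ p : n.Partition, (ferrersGraph p).rowLens = p.parts.sort (· ≥ ·) := fun p =>
    YoungDiagram.rowLens_ofRowLens_eq_self fun x hx => p.parts_pos ((Multiset.mem_sort _).1 hx)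
  ext1
  rw [← Multiset.sort_eq p.parts (· ≥ ·), ← Multiset.sort_eq q.parts (· ≥ ·), ← key, ← key, h]

lemma exists_ferrersGraph_eq (μ : YoungDiagram) :
    ∃ p : (#μ.cells).Partition, ferrersGraph p = μ := by
  have hsum : μ.rowLens.sum = #μ.cells := by
    conv_rhs => rw [← YoungDiagram.ofRowLens_to_rowLens_eq_self (μ := μ)]
    exact (card_cellsOfRowLens _).symm
  refine ⟨⟨(μ.rowLens : Multiset ℕ), fun hi => μ.pos_of_mem_rowLens _ (Multiset.mem_coe.1 hi),
    by rw [Multiset.sum_coe, hsum]⟩, ?_⟩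
  conv_rhs => rw [← YoungDiagram.ofRowLens_to_rowLens_eq_self (μ := μ)]
  have : (μ.rowLens : Multiset ℕ).sort (· ≥ ·) = μ.rowLens := by
    refine List.Perm.eq_of_pairwise' (r := (· ≥ ·)) (Multiset.pairwise_sort _ _)
      μ.rowLens_sorted.pairwise ?_
    rw [← Multiset.coe_eq_coe, Multiset.sort_eq]
  simp only [ferrersGraph, this]

/-! ### Partitions and pairs of finite sets -/

lemma pairWeight_eq_natCast (X Y : Finset ℕ) :
    pairWeight X Y = ((∑ x ∈ X, x + ∑ y ∈ Y, (y + 1) : ℕ) : ℤ) := by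
  rw [pairWeight, Nat.cast_add, Nat.cast_sum, Nat.cast_sum]
  simp only [Nat.cast_add, Nat.cast_one]

/-- The columns formed by the elements of two finite sets, each in decreasing order. -/
def zipDescending (X Y : Finset ℕ) : List (ℕ × ℕ) := (descending X).zip (descending Y)

lemma pairwise_descending (X : Finset ℕ) : (descending X).Pairwise (· > ·) :=
  (Finset.sortedGT_sort X).pairwise

lemma sum_map_descending {M : Type*} [AddCommMonoid M] (X : Finset ℕ) (f : ℕ → M) :
    ((descending X).map f).sum = ∑ x ∈ X, f x := by
  rw [descending, ← List.sum_toFinset f (Finset.sort_nodup X _), Finset.sort_toFinset]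

lemma descending_toFinset {l : List ℕ} (hl : l.Pairwise (· > ·)) : descending l.toFinset = l := by
  refine List.Perm.eq_of_pairwise' (r := (· > ·)) (pairwise_descending _) hl ?_
  refine (List.perm_ext_iff_of_nodup (Finset.sort_nodup _ _) (hl.imp fun h => ne_of_gt h)).2 ?_
  simp

lemma exists_partition_frobeniusSymbol_eq {n : ℕ} {X Y : Finset ℕ} (hc : charge X Y = 0)
    (hw : pairWeight X Y = n) :
    ∃ p : n.Partition, frobeniusSymbol (ferrersGraph p) = zipDescending X Y := by
  have hlen : (descending X).length = (descending Y).length := by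
    simp only [length_descending]; simp only [charge] at hc; omega
  have h1 : (zipDescending X Y).map Prod.fst = descending X := List.map_fst_zip hlen.le
  have h2 : (zipDescending X Y).map Prod.snd = descending Y := List.map_snd_zip hlen.ge
  obtain ⟨μ, hμ⟩ := exists_frobeniusSymbol_eq (L := zipDescending X Y) <| by
    rw [List.pairwise_and_iff]
    constructor
    · rw [← List.pairwise_map (f := Prod.fst) (R := (· > ·)), h1]
      exact pairwise_descending X
    · rw [← List.pairwise_map (f := Prod.snd) (R := (· > ·)), h2]
      exact pairwise_descending Y
  have hcard : #μ.cells = n := by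
    rw [card_eq_sum_frobeniusSymbol, hμ, List.sum_map_add]
    have e1 : ((zipDescending X Y).map fun c => c.1).sum = ∑ x ∈ X, x := by
      rw [show (fun c : ℕ × ℕ => c.1) = Prod.fst from rfl, h1]
      simpa using sum_map_descending X id
    have e2 : ((zipDescending X Y).map fun c => c.2 + 1).sum = ∑ y ∈ Y, (y + 1) := by
      rw [← sum_map_descending, ← h2, List.map_map]
      rfl
    rw [e1, e2]
    rwa [pairWeight_eq_natCast, Nat.cast_inj] at hw
  subst hcard
  obtain ⟨p, hp⟩ := exists_ferrersGraph_eq μ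
  exact ⟨p, by rw [hp, hμ]⟩

/-- The sets of the entries of the two rows of the Frobenius symbol of a partition. -/
def frobeniusSets {n : ℕ} (p : n.Partition) : Finset ℕ × Finset ℕ :=
  (((frobeniusSymbol (ferrersGraph p)).map Prod.fst).toFinset,
    ((frobeniusSymbol (ferrersGraph p)).map Prod.snd).toFinset)

lemma descending_frobeniusSets {n : ℕ} (p : n.Partition) :
    descending (frobeniusSets p).1 = (frobeniusSymbol (ferrersGraph p)).map Prod.fst ∧
      descending (frobeniusSets p).2 = (frobeniusSymbol (ferrersGraph p)).map Prod.snd := by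
  have h := pairwise_frobeniusSymbol (ferrersGraph p)
  exact ⟨descending_toFinset (List.pairwise_map.2 (h.imp And.left)),
    descending_toFinset (List.pairwise_map.2 (h.imp And.right))⟩

lemma zipDescending_frobeniusSets {n : ℕ} (p : n.Partition) :
    zipDescending (frobeniusSets p).1 (frobeniusSets p).2 = frobeniusSymbol (ferrersGraph p) := by
  rw [zipDescending, (descending_frobeniusSets p).1, (descending_frobeniusSets p).2,
    List.zip_map']
  exact List.map_id _

lemma charge_frobeniusSets {n : ℕ} (p : n.Partition) :
    charge (frobeniusSets p).1 (frobeniusSets p).2 = 0 := by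
  rw [charge, ← length_descending, ← length_descending, (descending_frobeniusSets p).1,
    (descending_frobeniusSets p).2]
  simp

lemma pairWeight_frobeniusSets {n : ℕ} (p : n.Partition) :
    pairWeight (frobeniusSets p).1 (frobeniusSets p).2 = n := by
  have h := card_eq_sum_frobeniusSymbol (ferrersGraph p)
  rw [card_ferrersGraph] at h
  rw [pairWeight, ← sum_map_descending, ← sum_map_descending, (descending_frobeniusSets p).1,
    (descending_frobeniusSets p).2, List.map_map, List.map_map, ← List.sum_map_add]
  conv_rhs => rw [h]
  rw [Nat.cast_list_sum, List.map_map]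
  congr 1

/-- The bounds differ because y contributes y + 1 to the weight. -/
lemma subset_range_of_pairWeight {k l n : ℕ} {X Y : Finset ℕ} (hw : pairWeight X Y = n)
    (hk : n < k) (hl : n ≤ l) : X ⊆ range k ∧ Y ⊆ range l := by
  have hw' : ∑ x ∈ X, x + ∑ y ∈ Y, (y + 1) = n := by
    rwa [pairWeight_eq_natCast, Nat.cast_inj] at hw
  constructor
  · intro x hx
    have := single_le_sum (f := fun x => x) (fun _ _ => Nat.zero_le _) hx
    rw [mem_range]
    omega
  · intro y hy
    have := single_le_sum (f := fun y => y + 1) (fun _ _ => Nat.zero_le _) hy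
    rw [mem_range]
    omega

/-- Partitions of `n` are in bijection with pairs of equinumerous finite sets of weight `n`. -/
theorem card_partition_filter {k l n : ℕ} (hk : n < k) (hl : n ≤ l)
    (P : List (ℕ × ℕ) → Prop) [DecidablePred P] :
    #{p : n.Partition | P (frobeniusSymbol (ferrersGraph p))} =
      ∑ X ∈ (range k).powerset, ∑ Y ∈ (range l).powerset,
        if charge X Y = 0 ∧ pairWeight X Y = n ∧ P (zipDescending X Y) then 1 else 0 := by
  rw [← sum_product', ← card_filter]
  refine card_bij (fun p _ => frobeniusSets p) ?_ ?_ ?_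
  · intro p hp
    obtain ⟨h1, h2⟩ := subset_range_of_pairWeight (pairWeight_frobeniusSets p) hk hl
    simp only [mem_filter, mem_product, mem_powerset, zipDescending_frobeniusSets]
    exact ⟨⟨h1, h2⟩, charge_frobeniusSets p, pairWeight_frobeniusSets p, (mem_filter.1 hp).2⟩
  · intro p _ q _ hpq
    apply ferrersGraph_injective
    apply frobeniusSymbol_injective
    rw [← zipDescending_frobeniusSets, ← zipDescending_frobeniusSets, hpq]
  · rintro ⟨X, Y⟩ h
    simp only [mem_filter] at h
    obtain ⟨_, hc, hw, hP⟩ := h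
    obtain ⟨p, hp⟩ := exists_partition_frobeniusSymbol_eq hc hw
    refine ⟨p, by simpa [hp] using hP, ?_⟩
    have hlen : (descending X).length = (descending Y).length := by
      simp only [length_descending]; simp only [charge] at hc; omega
    rw [frobeniusSets, hp, zipDescending, List.map_fst_zip hlen.le, List.map_snd_zip hlen.ge]
    simp [descending]

end ParityBlocks

namespace ParityBlocks

/-! ### Parity blocks and alternating sequences of signs -/

lemma alternates_append_of_ne {j : ℕ} {e : Bool} {l : List Bool} (t : List Bool)
    (hl : ∀ s ∈ l, s ≠ e) : alternates j e (l ++ t) = alternates j e t := by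
  cases j with
  | zero => simp [alternates]
  | succ j =>
    induction l with
    | nil => rfl
    | cons s l ih =>
      simp only [List.cons_append, alternates, if_neg (hl s List.mem_cons_self)]
      exact ih fun s hs => hl s (List.mem_cons_of_mem _ hs)

/-- The greedy search uses at most one sign of a constant run, so a parity block acts like a single
sign. -/
lemma alternates_block_append (j : ℕ) (e : Bool) {s : Bool} {l : List Bool} (t : List Bool)
    (hne : l ≠ []) (hl : ∀ s' ∈ l, s' = s) :
    alternates j e (l ++ t) = alternates j e (s :: t) := by
  by_cases he : s = e
  · obtain ⟨a, l, rfl⟩ := List.exists_cons_of_ne_nil hne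
    obtain rfl := hl a List.mem_cons_self
    cases j with
    | zero => simp [alternates]
    | succ j =>
      simp only [List.cons_append, alternates, if_pos he]
      exact alternates_append_of_ne t fun s' hs' => by
        rw [hl s' (List.mem_cons_of_mem _ hs'), he]; simp
  · rw [alternates_append_of_ne t fun s' hs' => by rwa [hl s' hs'],
      ← List.singleton_append, alternates_append_of_ne t (by simpa using he)]

lemma alternates_flatten {α : Type*} (f : α → Bool) (g : List α → Bool) {L : List (List α)}
    (hne : [] ∉ L) (hg : ∀ l ∈ L, ∀ a ∈ l, f a = g l) (j : ℕ) (e : Bool) :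
    alternates j e (L.flatten.map f) = alternates j e (L.map g) := by
  induction L generalizing j e with
  | nil => rfl
  | cons l L ih =>
    have hl : l ≠ [] := fun h => hne (by simp [h])
    have ih := ih (fun h => hne (List.mem_cons_of_mem _ h))
      fun l' hl' => hg l' (List.mem_cons_of_mem _ hl')
    rw [List.flatten_cons, List.map_append, alternates_block_append (s := g l) j e _ (by simpa)
      (by simpa using hg l List.mem_cons_self), List.map_cons]
    cases j with
    | zero => rfl
    | succ j => simp only [alternates, ih]

/-- When neighbouring signs differ, the longest alternating subsequence starting with `e` is the
whole list, or all but its first sign. -/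
lemma alternates_eq_decide {T : List Bool} (hT : T.IsChain (· ≠ ·)) (j : ℕ) (e : Bool) :
    alternates j e T = decide (j ≤ T.length - if T.head? = some e then 0 else 1) := by
  induction T generalizing j e with
  | nil => cases j <;> simp [alternates]
  | cons s T ih =>
    have ih := ih hT.tail
    have hhead : ∀ e', T.head? = some e' → e' = !s := by
      intro e' he'
      cases T with
      | nil => simp at he'
      | cons b T =>
        simp only [List.head?_cons, Option.some.injEq] at he'
        exact Bool.eq_not.2 (he' ▸ hT.rel.symm)
    have hhead' : T.head? ≠ some (!s) → T.length = 0 := by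
      intro h
      cases T with
      | nil => rfl
      | cons b T => exact absurd (congrArg some (hhead b rfl)) h
    cases j with
    | zero => simp [alternates]
    | succ j =>
      by_cases hs : s = e
      · subst hs
        simp only [alternates, if_true, ih, List.head?_cons, List.length_cons]
        by_cases h : T.head? = some (!s)
        · simp [h]
        · simp [h, hhead' h]
      · obtain rfl : e = !s := Bool.eq_not.2 (Ne.symm hs)
        simp only [alternates, if_neg hs, ih, List.head?_cons, List.length_cons]
        by_cases h : T.head? = some (!s)
        · simp [h]
        · simp [h, hhead' h]

lemma head?_eq_of_getLast?_eq {T : List Bool} (hT : T.IsChain (· ≠ ·)) {δ : Bool}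
    (h : T.getLast? = some δ) : T.head? = some (if T.length % 2 = 1 then δ else !δ) := by
  induction T with
  | nil => simp at h
  | cons s T ih =>
    cases T with
    | nil => simpa using h
    | cons b T =>
      have h1 := ih hT.tail (by simpa using h)
      have h2 := Bool.eq_not.2 hT.rel
      simp only [List.head?_cons, Option.some.injEq, List.length_cons] at h1 ⊢
      rw [h2, h1]
      rcases Nat.mod_two_eq_zero_or_one T.length with h3 | h3 <;>
        simp [Nat.add_mod, h3]

/-- The sign with which an alternating sequence of `j` signs that ends with `δ` starts. -/
def startSign (j : ℕ) (δ : Bool) : Bool := if j % 2 = 1 then δ else !δ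

/-- If the longest alternation from the start sign has length exactly `j`, the blocks begin with
that sign and number `j`, or begin with the other and number `j + 1`. Either way the last sign is
`δ`. -/
lemma alternates_sub_alternates {T : List Bool} (hT : T.IsChain (· ≠ ·)) (hne : T ≠ []) (j : ℕ)
    (δ : Bool) :
    (if alternates j (startSign j δ) T = true then 1 else 0 : ℤ) =
      (if alternates (j + 1) (startSign j δ) T = true then 1 else 0) +
        ((if T.length = j ∧ T.getLast? = some δ then 1 else 0) +
          if T.length = j + 1 ∧ T.getLast? = some δ then 1 else 0) := by
  have hpos : 0 < T.length := List.length_pos_iff.2 hne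
  obtain ⟨δ', hδ'⟩ : ∃ δ', T.getLast? = some δ' := ⟨_, List.getLast?_eq_some_getLast hne⟩
  simp only [alternates_eq_decide hT, head?_eq_of_getLast?_eq hT hδ', hδ', startSign,
    Option.some.injEq, decide_eq_true_eq]
  by_cases hd : δ' = δ
  · subst hd
    split_ifs <;> grind
  · obtain rfl : δ' = !δ := Bool.eq_not.2 hd
    split_ifs <;> grind

/-- The sign of a column of a Frobenius symbol. -/
def columnSign (c : ℕ × ℕ) : Bool := decide (c.2 < c.1)

lemma columnPositive_iff (c : ℕ × ℕ) : ColumnPositive c ↔ columnSign c = true := by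
  simp only [ColumnPositive, columnSign, decide_eq_true_eq]; omega

lemma columnNegative_iff (c : ℕ × ℕ) : ColumnNegative c ↔ columnSign c = false := by
  simp only [ColumnNegative, columnSign, decide_eq_false_iff_not]; omega

lemma sameParity_iff (c c' : ℕ × ℕ) : SameParity c c' ↔ columnSign c = columnSign c' := by
  simp only [SameParity, columnPositive_iff, columnNegative_iff]
  cases columnSign c <;> cases columnSign c' <;> simp

/-- The sign of a parity block, read off from its first column. -/
def blockSign (B : List (ℕ × ℕ)) : Bool := (B.map columnSign).headD true

section

variable {n : ℕ} (p : n.Partition)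

lemma columnSign_eq_blockSign {B : List (ℕ × ℕ)} (hB : B ∈ parityBlocks p) {c : ℕ × ℕ}
    (hc : c ∈ B) : columnSign c = blockSign B := by
  have hchain := List.isChain_of_mem_splitBy hB
  simp only [decide_eq_true_eq, sameParity_iff] at hchain
  cases B with
  | nil => simp at hc
  | cons a B =>
    rcases List.mem_cons.1 hc with rfl | hc
    · rfl
    · have : (a :: B).Pairwise fun c c' => columnSign c = columnSign c' :=
        haveI : Trans (fun c c' : ℕ × ℕ => columnSign c = columnSign c')
          (fun c c' => columnSign c = columnSign c') (fun c c' => columnSign c = columnSign c') :=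
          ⟨Eq.trans⟩
        List.isChain_iff_pairwise.1 hchain
      exact (List.rel_of_pairwise_cons this hc).symm

lemma isChain_blockSigns : ((parityBlocks p).map blockSign).IsChain (· ≠ ·) := by
  rw [List.isChain_map]
  have h := List.isChain_getLast_head_splitBy (fun c c' => decide (SameParity c c'))
    (frobeniusSymbol (ferrersGraph p))
  refine List.IsChain.imp_of_mem_imp ?_ h
  rintro A B hA hB ⟨ha, hb, hab⟩
  rw [decide_eq_false_iff_not, sameParity_iff, columnSign_eq_blockSign p hA (List.getLast_mem ha),
    columnSign_eq_blockSign p hB (List.head_mem hb)] at hab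
  exact hab

lemma alternates_blockSigns (j : ℕ) (e : Bool) :
    alternates j e ((frobeniusSymbol (ferrersGraph p)).map columnSign) =
      alternates j e ((parityBlocks p).map blockSign) := by
  conv_lhs => rw [← List.flatten_splitBy (fun c c' => decide (SameParity c c'))
    (frobeniusSymbol (ferrersGraph p))]
  exact alternates_flatten _ _ (List.nil_notMem_splitBy _ _)
    (fun B hB c hc => columnSign_eq_blockSign p hB hc) j e

lemma forall_columnSign_iff {B : List (ℕ × ℕ)} (hB : B ∈ parityBlocks p) (δ : Bool) :
    (∀ c ∈ B, columnSign c = δ) ↔ blockSign B = δ := by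
  obtain ⟨c, hc⟩ := List.exists_mem_of_ne_nil B (List.ne_nil_of_mem_splitBy hB)
  constructor
  · intro h
    rw [← columnSign_eq_blockSign p hB hc, h c hc]
  · rintro rfl c hc
    exact columnSign_eq_blockSign p hB hc

lemma getLast?_blockSigns_iff (δ : Bool) :
    ((parityBlocks p).map blockSign).getLast? = some δ ↔
      ∃ B ∈ (parityBlocks p).getLast?, ∀ c ∈ B, columnSign c = δ := by
  rw [List.getLast?_map, Option.map_eq_some_iff]
  refine exists_congr fun B => and_congr_right fun hB => ?_
  exact (forall_columnSign_iff p (List.mem_of_getLast? hB) δ).symm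

lemma lastBlockPositive_iff :
    LastBlockPositive p ↔ ((parityBlocks p).map blockSign).getLast? = some true := by
  simp only [getLast?_blockSigns_iff, LastBlockPositive, columnPositive_iff]

lemma lastBlockNegative_iff :
    LastBlockNegative p ↔ ((parityBlocks p).map blockSign).getLast? = some false := by
  simp only [getLast?_blockSigns_iff, LastBlockNegative, columnNegative_iff]

lemma parityBlocks_ne_nil (hn : 1 ≤ n) : parityBlocks p ≠ [] := by
  intro h
  have h := List.splitBy_eq_nil.1 h
  have hc := card_eq_sum_frobeniusSymbol (ferrersGraph p)
  rw [card_ferrersGraph, h] at hc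
  simp at hc
  omega

end

/-! ### Block counts as differences of alternation counts. -/

/-- The number of partitions of `n` with `m` parity blocks, the last of which has sign `δ`. -/
def blockCount (n m : ℕ) (δ : Bool) : ℕ :=
  (Finset.univ.filter fun p : n.Partition => ((parityBlocks p).map blockSign).length = m ∧
    ((parityBlocks p).map blockSign).getLast? = some δ).card

lemma aPos_eq (m n : ℕ) : aPos m n = blockCount n m true := by
  classical
  rw [aPos, Nat.card_eq_fintype_card, Fintype.card_subtype, blockCount]
  simp only [lastBlockPositive_iff, List.length_map]

lemma aNeg_eq (m n : ℕ) : aNeg m n = blockCount n m false := by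
  classical
  rw [aNeg, Nat.card_eq_fintype_card, Fintype.card_subtype, blockCount]
  simp only [lastBlockNegative_iff, List.length_map]

/-- The number of partitions of `n` whose columns have an alternating sequence of `j` signs that
starts with the sign `e`. -/
def alternatingPartitionCount (n j : ℕ) (e : Bool) : ℕ :=
  (Finset.univ.filter fun p : n.Partition =>
    alternates j e ((frobeniusSymbol (ferrersGraph p)).map columnSign) = true).card

lemma blockCount_add_blockCount {n : ℕ} (hn : 1 ≤ n) (j : ℕ) (δ : Bool) :
    (blockCount n j δ + blockCount n (j + 1) δ : ℤ) =
      alternatingPartitionCount n j (startSign j δ) -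
        alternatingPartitionCount n (j + 1) (startSign j δ) := by
  rw [eq_sub_iff_add_eq']
  simp only [blockCount, alternatingPartitionCount, Finset.card_filter, Nat.cast_sum,
    ← Finset.sum_add_distrib]
  refine Finset.sum_congr rfl fun p _ => ?_
  rw [alternates_blockSigns, alternates_blockSigns]
  push_cast
  exact (alternates_sub_alternates (isChain_blockSigns p)
    (by simpa using parityBlocks_ne_nil p hn) j δ).symm

lemma blockCount_zero {n : ℕ} (hn : 1 ≤ n) (δ : Bool) : blockCount n 0 δ = 0 := by
  rw [blockCount, Finset.card_eq_zero, Finset.filter_eq_empty_iff]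
  rintro p - ⟨h, -⟩
  exact parityBlocks_ne_nil p hn (by simpa using h)

end ParityBlocks

namespace ParityBlocks

/-! ### Counting pairs of finite sets by the partition function -/

lemma partitionCount_of_neg {k : ℤ} (hk : k < 0) : partitionCount k = 0 := if_neg (not_le.2 hk)

lemma partitionCount_natCast (n : ℕ) : partitionCount n = Fintype.card n.Partition := by
  simp [partitionCount]

lemma pairCount_charge_zero {k l : ℕ} {n : ℤ} (hk : n < k) (hl : n ≤ l) :
    (pairCount k l 0 n : ℤ) = partitionCount n := by
  rcases lt_or_ge n 0 with hn | hn
  · rw [pairCount_of_neg _ _ _ hn, partitionCount_of_neg hn, Nat.cast_zero]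
  · lift n to ℕ using hn
    have h := card_partition_filter (n := n) (k := k) (l := l) (by omega) (by omega) fun _ => True
    rw [partitionCount_natCast, Nat.cast_inj, ← Finset.card_univ]
    simpa [pairCount] using h.symm

/-- Repeated shifts reduce charge d to charge 0 at a total weight of 0 + 1 + ... + (d - 1). The
weight bounds make the boundary terms of the recursions vanish, so the ranges need not change. -/
lemma pairCount_natCast_charge (d : ℕ) {k l : ℕ} {n : ℤ} (hk : n < k) (hl : n ≤ l) :
    (pairCount k l d n : ℤ) = partitionCount (n - d * (d - 1) / 2) := by
  induction d generalizing n with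
  | zero => simpa using pairCount_charge_zero hk hl
  | succ d ih =>
    have h := pairCount_shift k l d (n - d)
    rw [sub_add_cancel, pairCount_succ_left_of_lt l _ hk] at h
    have hdiv : (((d + 1 : ℕ) : ℤ) * ((d + 1 : ℕ) - 1)) / 2 = d * (d - 1) / 2 + d := by
      rw [← Int.add_mul_ediv_right _ _ two_ne_zero]
      congr 1
      push_cast
      ring
    rw [hdiv, Nat.cast_succ, ← h, pairCount_succ_right, pairCount_of_neg k l (d + 1), add_zero,
      ih (by omega) (by omega)]
    · congr 1
      ring
    · omega

lemma pairCount_eq_partitionCount (d : ℤ) {k : ℕ} {n : ℤ} (hk : n < k) :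
    (pairCount k k d n : ℤ) = partitionCount (n - d * (d - 1) / 2) := by
  obtain ⟨m, rfl | rfl⟩ := d.eq_nat_or_neg
  · exact pairCount_natCast_charge m hk hk.le
  · rw [pairCount_swap, neg_neg, pairCount_natCast_charge m (by omega) (by omega)]
    have hdiv : -(m : ℤ) * (-m - 1) / 2 = m * (m - 1) / 2 + m := by
      rw [← Int.add_mul_ediv_right _ _ two_ne_zero]
      congr 1
      ring
    rw [hdiv]
    congr 1
    ring

/-! ### Pentagonal numbers from iterated reflections. -/

lemma alternatingPartitionCount_eq_alternatingCount (n j : ℕ) (e : Bool) :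
    alternatingPartitionCount n j e = alternatingCount (n + 1) (n + 1) 0 j e n := by
  refine (card_partition_filter n.lt_succ_self n.le_succ fun L =>
    alternates j e (L.map columnSign) = true).trans ?_
  simp only [alternatingCount, columnSigns, zipDescending, List.map_zip_eq_zipWith,
    neg_zero, Int.toNat_zero, List.drop_zero]
  rfl

lemma reflectedShift_nonneg (j : ℕ) : 0 ≤ reflectedShift j true ∧ 0 ≤ reflectedShift j false := by
  induction j with
  | zero => simp [reflectedShift]
  | succ j ih =>
    have := reflectedCharge_sign j
    simp only [reflectedShift, reflectedCharge]
    omega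

lemma reflectedCharge_two_mul (i : ℕ) :
    reflectedCharge (2 * i) true = 3 * i ∧ reflectedCharge (2 * i) false = -(3 * i) ∧
      reflectedCharge (2 * i + 1) true = 3 * i + 2 ∧
      reflectedCharge (2 * i + 1) false = -(3 * i) - 1 := by
  induction i with
  | zero => simp [reflectedCharge]
  | succ i ih =>
    simp only [Nat.mul_succ, reflectedCharge] at ih ⊢
    push_cast
    omega

lemma reflectedShift_two_mul (i : ℕ) :
    2 * reflectedShift (2 * i) true = i * (3 * i + 1) ∧
      2 * reflectedShift (2 * i) false = i * (3 * i - 1) ∧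
      2 * reflectedShift (2 * i + 1) true = (i + 1) * (3 * i + 2) ∧
      2 * reflectedShift (2 * i + 1) false = i * (3 * i + 1) := by
  induction i with
  | zero => simp [reflectedShift, reflectedCharge]
  | succ i ih =>
    have hc := reflectedCharge_two_mul i
    have h1 : reflectedShift (2 * (i + 1)) true =
        reflectedShift (2 * i) true + (3 * i + 2) := by
      simp only [Nat.mul_succ, reflectedShift, reflectedCharge] at hc ⊢
      linarith
    have h2 : reflectedShift (2 * (i + 1)) false = reflectedShift (2 * i + 1) true := rfl
    have h3 : reflectedShift (2 * (i + 1) + 1) true =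
        reflectedShift (2 * (i + 1)) false + (3 * i + 4) := by
      simp only [reflectedShift, (reflectedCharge_two_mul (i + 1)).2.2.1]
      push_cast
      ring
    have h4 : reflectedShift (2 * (i + 1) + 1) false = reflectedShift (2 * (i + 1)) true := rfl
    rw [h3, h4, h1, h2]
    push_cast
    exact ⟨by linear_combination ih.1, by linear_combination ih.2.2.1,
      by linear_combination ih.2.2.1, by linear_combination ih.1⟩

/-- The generalized pentagonal numbers `j (3 j + 1) / 2` and `j (3 j - 1) / 2`. -/
def pentagonalNumber (j : ℕ) (δ : Bool) : ℤ :=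
  if δ then (3 * (j : ℤ) ^ 2 + j) / 2 else (3 * (j : ℤ) ^ 2 - j) / 2

/-- The pentagonal number is the weight lost in the reflections plus the minimal weight d(d-1)/2 of
a pair of the reflected charge d. -/
lemma pentagonalNumber_eq (j : ℕ) (δ : Bool) :
    pentagonalNumber j δ = reflectedShift j (startSign j δ) +
      reflectedCharge j (startSign j δ) * (reflectedCharge j (startSign j δ) - 1) / 2 := by
  suffices h : (if δ then 3 * (j : ℤ) ^ 2 + j else 3 * (j : ℤ) ^ 2 - j) =
      reflectedCharge j (startSign j δ) * (reflectedCharge j (startSign j δ) - 1) +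
        reflectedShift j (startSign j δ) * 2 by
    rw [add_comm, ← Int.add_mul_ediv_right _ _ two_ne_zero, ← h, pentagonalNumber]
    split_ifs <;> rfl
  obtain ⟨i, rfl | rfl⟩ := j.even_or_odd'
  · obtain ⟨c1, c2, -⟩ := reflectedCharge_two_mul i
    obtain ⟨s1, s2, -⟩ := reflectedShift_two_mul i
    cases δ
    · simp [startSign, c1]
      linear_combination -s1
    · simp [startSign, c2]
      linear_combination -s2
  · obtain ⟨-, -, c1, c2⟩ := reflectedCharge_two_mul i
    obtain ⟨-, -, s1, s2⟩ := reflectedShift_two_mul i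
    cases δ
    · simp [startSign, c2]
      linear_combination -s2
    · simp [startSign, c1]
      linear_combination -s1

theorem alternatingPartitionCount_eq (n j : ℕ) (δ : Bool) :
    (alternatingPartitionCount n j (startSign j δ) : ℤ) =
      partitionCount (n - pentagonalNumber j δ) := by
  rw [alternatingPartitionCount_eq_alternatingCount, alternatingCount_eq _ _ _ _ _ (by simp),
    sub_zero, pairCount_eq_partitionCount, pentagonalNumber_eq, sub_add_eq_sub_sub]
  -- The shift only lowers the weight, which therefore stays below the range bound `n + 1`.
  have := reflectedShift_nonneg j
  cases startSign j δ <;> push_cast <;> omega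

lemma startSign_succ_not (j : ℕ) (δ : Bool) : startSign (j + 1) (!δ) = startSign j δ := by
  unfold startSign
  rcases Nat.mod_two_eq_zero_or_one j with h | h <;> simp [Nat.add_mod, h]

/-- The difference of values of the partition function that counts, for `1 ≤ n`, the partitions of
`n` with `l` or `l + 1` parity blocks, the last of sign `δ`. -/
def pentagonalDifference (n l : ℕ) (δ : Bool) : ℤ :=
  partitionCount (n - pentagonalNumber l δ) - partitionCount (n - pentagonalNumber (l + 1) (!δ))

lemma blockCount_add_succ {n : ℕ} (hn : 1 ≤ n) (l : ℕ) (δ : Bool) :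
    (blockCount n l δ + blockCount n (l + 1) δ : ℤ) = pentagonalDifference n l δ := by
  rw [blockCount_add_blockCount hn, pentagonalDifference, alternatingPartitionCount_eq,
    ← startSign_succ_not, alternatingPartitionCount_eq]

theorem blockCount_eq {n : ℕ} (hn : 1 ≤ n) (m : ℕ) (δ : Bool) :
    (blockCount n (m + 1) δ : ℤ) =
      (-1) ^ m * ∑ l ∈ Finset.range (m + 1), (-1) ^ l * pentagonalDifference n l δ := by
  induction m with
  | zero =>
    have := blockCount_add_succ hn 0 δ
    rw [blockCount_zero hn] at this
    simpa using this
  | succ m ih =>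
    rw [Finset.sum_range_succ, mul_add, pow_succ, mul_assoc, mul_assoc, ← mul_assoc _ _ (_ * _),
      ← blockCount_add_succ hn]
    have hsq : ((-1) ^ m : ℤ) * (-1) ^ m = 1 := by rw [← mul_pow]; simp
    linear_combination -ih - ((blockCount n (m + 1) δ : ℤ) + blockCount n (m + 1 + 1) δ) * hsq

/-! ### Generating functions -/

open PowerSeries

/-- The generating function of the partition function. -/
noncomputable def partitionSeries : PowerSeries ℚ := PowerSeries.mk fun n => (partitionCount n : ℚ)

open scoped PowerSeries.WithPiTopology in
lemma partitionSeries_mul_qqInfinity : partitionSeries * qqInfinity = 1 := by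
  have h1 := Nat.Partition.hasProd_powerSeriesMk_card_restricted ℚ fun _ => True
  have h2 := (WithPiTopology.multipliable_one_sub_X_pow ℚ).hasProd
  have h := h1.mul h2
  have hone : (fun i : ℕ => (if True then ∑' j : ℕ, (X : ℚ⟦X⟧) ^ ((i + 1) * j) else 1) *
      (1 - X ^ (i + 1))) = fun _ => 1 := by
    funext i
    simp_rw [if_true, pow_mul]
    exact WithPiTopology.tsum_pow_mul_one_sub_of_constantCoeff_eq_zero (by simp)
  rw [hone] at h
  have hmk : partitionSeries =
      PowerSeries.mk fun n => ((Nat.Partition.restricted n fun _ => True).card : ℚ) := by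
    ext n
    simp [partitionSeries, partitionCount_natCast, Nat.Partition.restricted]
  rw [hmk]
  exact h.unique hasProd_one

lemma inv_qqInfinity : qqInfinity⁻¹ = partitionSeries := by
  have h := partitionSeries_mul_qqInfinity
  rw [eq_comm, PowerSeries.eq_inv_iff_mul_eq_one, h]
  intro h0
  have := congrArg constantCoeff h
  simp [h0] at this

lemma coeff_partitionSeries_mul_X_pow (n a : ℕ) :
    coeff n (partitionSeries * X ^ a) = (partitionCount (n - a) : ℚ) := by
  rw [coeff_mul_X_pow']
  split_ifs with h
  · rw [partitionSeries, coeff_mk, Nat.cast_sub h]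
  · rw [partitionCount_of_neg (by omega), Int.cast_zero]

/-- Only the term `l = 0` contributes at `n = 0`; it is cancelled by the constant (-1)^m of the
generating function. -/
lemma pentagonalDifference_zero (l : ℕ) (δ : Bool) :
    pentagonalDifference 0 l δ = if l = 0 then 1 else 0 := by
  have hpos : ∀ l δ, 0 < pentagonalNumber (l + 1) δ := by
    intro l δ
    cases δ <;> simp only [pentagonalNumber] <;> push_cast <;>
      exact Int.lt_of_lt_of_le one_pos (Int.le_ediv_of_mul_le two_pos (by norm_num; nlinarith))
  rw [pentagonalDifference, partitionCount_of_neg (k := _ - pentagonalNumber (l + 1) _)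
    (by simpa using hpos l (!δ)), sub_zero]
  cases l with
  | zero =>
    have h0 : pentagonalNumber 0 δ = 0 := by cases δ <;> simp [pentagonalNumber]
    simp [h0, partitionCount]
  | succ l => exact partitionCount_of_neg (by simpa using hpos l δ)

/-- The exponents `a` and `b` are parameters so that both signs are treated at once. -/
lemma genSeries_blockCount (m : ℕ) (δ : Bool) (a b : ℕ → ℕ)
    (ha : ∀ l, (a l : ℤ) = pentagonalNumber l δ)
    (hb : ∀ l, (a l + b l : ℤ) = pentagonalNumber (l + 1) (!δ)) :
    genSeries (fun n => blockCount n (m + 1) δ) =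
      (-1) ^ (m + 1) + (-1) ^ m * qqInfinity⁻¹ *
        ∑ l ∈ Finset.range (m + 1), (-1) ^ l * X ^ a l * (1 - X ^ b l) := by
  have hC : ∀ k : ℕ, ((-1) ^ k : ℚ⟦X⟧) = C ((-1) ^ k) := by simp
  have hterm : ∀ n l, coeff n (partitionSeries * ((-1) ^ l * X ^ a l * (1 - X ^ b l))) =
      (-1) ^ l * (pentagonalDifference n l δ : ℚ) := by
    intro n l
    rw [show partitionSeries * ((-1) ^ l * X ^ a l * (1 - X ^ b l)) =
      C ((-1) ^ l) * (partitionSeries * X ^ a l - partitionSeries * X ^ (a l + b l)) by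
        rw [← hC]; ring, coeff_C_mul, map_sub, coeff_partitionSeries_mul_X_pow,
      coeff_partitionSeries_mul_X_pow, pentagonalDifference, ← ha, ← hb]
    push_cast
    rfl
  ext n
  rw [inv_qqInfinity, mul_assoc, Finset.mul_sum, map_add, hC, hC, coeff_C_mul, map_sum, coeff_C,
    genSeries, coeff_mk]
  simp only [hterm]
  obtain rfl | hn : n = 0 ∨ 1 ≤ n := by omega
  · simp [pentagonalDifference_zero, pow_succ]
  · rw [if_pos hn, if_neg (by omega), zero_add, ← Int.cast_natCast, blockCount_eq hn]
    push_cast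
    rfl

end ParityBlocks

theorem theorem1p2 (m : ℕ) (hm : 1 ≤ m) :
    -- the two generating functions, as formal power series in `q = X`
    ParityBlocks.genSeries (ParityBlocks.aPos m) =
        (-1) ^ m + (-1) ^ (m - 1) * (ParityBlocks.qqInfinity)⁻¹ *
          ∑ l ∈ Finset.range m, (-1) ^ l * PowerSeries.X ^ (l * (3 * l + 1) / 2) *
            (1 - PowerSeries.X ^ (2 * l + 1)) ∧
    ParityBlocks.genSeries (ParityBlocks.aNeg m) =
        (-1) ^ m + (-1) ^ (m - 1) * (ParityBlocks.qqInfinity)⁻¹ *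
          ∑ l ∈ Finset.range m, (-1) ^ l * PowerSeries.X ^ (l * (3 * l - 1) / 2) *
            (1 - PowerSeries.X ^ (4 * l + 2)) ∧
    -- the two formulas in terms of the partition function
    (∀ n : ℕ, 1 ≤ n →
      (ParityBlocks.aPos m n : ℤ) = (-1) ^ (m - 1) * ∑ l ∈ Finset.range m, (-1) ^ l *
        (ParityBlocks.partitionCount (n - (3 * (l : ℤ) ^ 2 + l) / 2) -
          ParityBlocks.partitionCount (n - (3 * ((l : ℤ) + 1) ^ 2 - (l + 1)) / 2))) ∧
    (∀ n : ℕ, 1 ≤ n →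
      (ParityBlocks.aNeg m n : ℤ) = (-1) ^ (m - 1) * ∑ l ∈ Finset.range m, (-1) ^ l *
        (ParityBlocks.partitionCount (n - (3 * (l : ℤ) ^ 2 - l) / 2) -
          ParityBlocks.partitionCount (n - (3 * ((l : ℤ) + 1) ^ 2 + (l + 1)) / 2))) := by
  obtain ⟨m, rfl⟩ : ∃ k, m = k + 1 := ⟨m - 1, by omega⟩
  have hPos : ParityBlocks.aPos (m + 1) = fun n => ParityBlocks.blockCount n (m + 1) true :=
    funext (ParityBlocks.aPos_eq (m + 1))
  have hNeg : ParityBlocks.aNeg (m + 1) = fun n => ParityBlocks.blockCount n (m + 1) false :=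
    funext (ParityBlocks.aNeg_eq (m + 1))
  rw [Nat.add_sub_cancel, hPos, hNeg]
  refine ⟨ParityBlocks.genSeries_blockCount m true _ _ (fun l => ?_) fun l => ?_,
    ParityBlocks.genSeries_blockCount m false _ _ (fun l => ?_) fun l => ?_,
    fun n hn => ?_, fun n hn => ?_⟩
  · simp only [ParityBlocks.pentagonalNumber, if_true]
    push_cast
    congr 1
    ring
  · simp only [ParityBlocks.pentagonalNumber, Bool.not_true, Bool.false_eq_true, if_false]
    push_cast
    rw [← Int.add_mul_ediv_right _ _ two_ne_zero]
    congr 1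
    ring
  -- At `l = 0` the natural subtraction `3 * l - 1` truncates, harmlessly because of the factor `l`.
  · rcases Nat.eq_zero_or_pos l with rfl | hl
    · simp [ParityBlocks.pentagonalNumber]
    · simp only [ParityBlocks.pentagonalNumber, Bool.false_eq_true, if_false]
      push_cast [Nat.cast_sub (show 1 ≤ 3 * l by omega)]
      congr 1
      ring
  · rcases Nat.eq_zero_or_pos l with rfl | hl
    · simp [ParityBlocks.pentagonalNumber]
    · simp only [ParityBlocks.pentagonalNumber, Bool.not_false, if_true]
      push_cast [Nat.cast_sub (show 1 ≤ 3 * l by omega)]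
      rw [← Int.add_mul_ediv_right _ _ two_ne_zero]
      congr 1
      ring
  · rw [ParityBlocks.blockCount_eq hn]
    simp [ParityBlocks.pentagonalDifference, ParityBlocks.pentagonalNumber]
  · rw [ParityBlocks.blockCount_eq hn]
    simp [ParityBlocks.pentagonalDifference, ParityBlocks.pentagonalNumber]
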